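/- **Lemma.** A *free mapping* is an orientation-preserving homeomorphism $f$ of $\mathbb{R}^2$ with no fixed points. It is *embedded in a flow* $\{\bar f^{\rho}\}_{\rho\in\mathbb{R}}$ if each $\bar f^{\rho}$ is a homeomorphism of $\mathbb{R}^2$, $\bar f^{\rho}(p)$ is jointly continuous in $(\rho,p)$, $\bar f^{\alpha}\circ\bar f^{\beta}=\bar f^{\alpha+\beta}$ for all $\alpha,\beta\in\mathbb{R}$, and $\bar f^{1}=f$. Let $f$ be a free mapping embedded in a flow $\{\bar f^{\rho}\}$. For $x\in\mathbb{R}^2$ let $[x]_f=\{f^n(x):n\in\mathbb{Z}\}$ be its orbit and $L_x=\{\bar f^{\rho}(x):\rho\in\mathbb{R}\}$ its flowline. Let $\mathbb{R}^2/\langle f\rangle$ be the space of orbits and let $V_f$ be the leaf space, i.e. the quotient of $\mathbb{R}^2$ by the relation $x\approx y\iff L_x=L_y$, both with the quotient topology. Then the natural map $$\varphi_f:\mathbb{R}^2/\langle f\rangle\to V_f,\qquad [x]_f\mapsto [x]_{\approx},$$ is a fiber bundle with fiber $\mathbb{S}^1$: every point of $V_f$ has an open neighborhood $U$ for which there is a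 homeomorphism $h:\varphi_f^{-1}(U)\to U\times\mathbb{S}^1$ whose first component is $\varphi_f$. -/

import Mathlib

/-- The Euclidean plane `ℝ²`. -/
abbrev Plane : Type := EuclideanSpace ℝ (Fin 2)

/-- A homeomorphism `f` of the plane is orientation preserving if it has local degree `1`
at every point `x`: the image under `f` of the counterclockwise unit circle around `x`, written
in polar coordinates `(r, θ)` around `f x` with a continuous angle `θ`, has winding number `1`
around `f x`. -/
def IsOrientationPreserving (f : Plane ≃ₜ Plane) : Prop :=
  ∀ x : Plane, ∃ r θ : ℝ → ℝ, Continuous θ ∧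
    (∀ t : ℝ, 0 < r t ∧
      f (x + !₂[Real.cos t, Real.sin t]) = f x + r t • !₂[Real.cos (θ t), Real.sin (θ t)]) ∧
    θ (2 * Real.pi) = θ 0 + 2 * Real.pi

/-- A free mapping is an orientation preserving homeomorphism of the plane without fixed
points. -/
structure IsFreeMapping (f : Plane ≃ₜ Plane) : Prop where
  orientationPreserving : IsOrientationPreserving f
  fixedPointFree : ∀ x : Plane, f x ≠ x

/-- `f` is embedded in the flow `φ` (a jointly continuous action of `(ℝ, +)` on the plane) if
`f` is the time-one map of `φ`. -/
def IsEmbeddedIn (f : Plane ≃ₜ Plane) (φ : Flow ℝ Plane) : Prop :=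
  ∀ x : Plane, φ 1 x = f x

/-- The equivalence relation whose classes are the orbits `[x]_f = {f ^ n x : n ∈ ℤ}`. -/
def orbitSetoid (f : Plane ≃ₜ Plane) : Setoid Plane where
  r x y := ∃ n : ℤ, (f ^ n) x = y
  iseqv :=
    { refl := fun x => ⟨0, by simp⟩
      symm := by
        rintro x y ⟨n, rfl⟩
        exact ⟨-n, by rw [← Homeomorph.mul_apply, ← zpow_add]; simp⟩
      trans := by
        rintro x y z ⟨n, rfl⟩ ⟨m, rfl⟩
        exact ⟨m + n, by rw [zpow_add, Homeomorph.mul_apply]⟩ }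

/-- The orbit space `ℝ² / ⟨f⟩`, with the quotient topology. -/
abbrev OrbitSpace (f : Plane ≃ₜ Plane) : Type := Quotient (orbitSetoid f)

/-- Two points are related if they lie on the same flowline
`L_x = {φ ρ x : ρ ∈ ℝ}` of the flow `φ`. -/
def flowlineSetoid (φ : Flow ℝ Plane) : Setoid Plane :=
  Setoid.ker fun x => φ.orbit x

/-- The leaf space of the decomposition of the plane into the flowlines of `φ`, with the
quotient topology. -/
abbrev LeafSpace (φ : Flow ℝ Plane) : Type := Quotient (flowlineSetoid φ)

theorem flow_orbit_map (φ : Flow ℝ Plane) (t : ℝ) (x : Plane) :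
    φ.orbit (φ t x) = φ.orbit x := by
  ext y
  simp only [Flow.mem_orbit_iff]
  constructor
  · rintro ⟨s, rfl⟩
    exact ⟨s + t, φ.map_add s t x⟩
  · rintro ⟨s, rfl⟩
    exact ⟨s - t, by rw [← φ.map_add, sub_add_cancel]⟩

theorem IsEmbeddedIn.orbit_zpow {f : Plane ≃ₜ Plane} {φ : Flow ℝ Plane}
    (h : IsEmbeddedIn f φ) (n : ℤ) (x : Plane) : φ.orbit ((f ^ n) x) = φ.orbit x := by
  have h1 : ∀ y, φ.orbit (f y) = φ.orbit y := fun y => by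
    rw [← h y]
    exact flow_orbit_map φ 1 y
  induction n with
  | zero => simp
  | succ n ih => rw [add_comm, zpow_add, Homeomorph.mul_apply, zpow_one, h1, ih]
  | pred n ih =>
    rw [← ih, ← h1, ← Homeomorph.mul_apply, ← zpow_one_add]
    congr 3
    ring

/-- The natural map `ℝ² / ⟨f⟩ → V_f`, `[x]_f ↦ L_x`. -/
def orbitToLeaf {f : Plane ≃ₜ Plane} {φ : Flow ℝ Plane} (h : IsEmbeddedIn f φ) :
    OrbitSpace f → LeafSpace φ :=
  Quotient.map id <| by
    rintro x y ⟨n, rfl⟩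
    exact (h.orbit_zpow n x).symm

/-- `p : E → B` is a (locally trivial) fiber bundle with fiber `F`: every point of `B` has an open
neighborhood `U` with a homeomorphism `p ⁻¹ U ≃ U × F` over `U`. -/
def IsFiberBundle (F : Type*) {E B : Type*} [TopologicalSpace F] [TopologicalSpace E]
    [TopologicalSpace B] (p : E → B) : Prop :=
  ∀ b : B, ∃ e : Bundle.Trivialization F p, b ∈ e.baseSet

/-!
The orbit space is trivialized over a union `W` of flowlines as soon as `W` is open and carries a
continuous time coordinate `T` with `T (φ t y) = T y + t`: the orbit of `y` corresponds to the
flowline of `y` together with `T y` modulo `1`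
(`exists_trivialization_of_time_coordinate`). Such a coordinate is the time since the crossing of a
local section, provided that no flowline crosses the section twice; so the theorem amounts to the
fact that a point has a local section to which flowlines do not return
(`Flow.exists_isLocalSection_eq_zero`).

Local sections exist because the flow has no stationary point: the average of a suitable linear
functional over a time interval increases along the flow near the given point, and its level set is
a section (`Flow.exists_isLocalSection`). That flowlines do not return is where the plane enters.
The map `φ s` with `s = 1 / n` has no fixed point, because `φ 1` has none. A flowline that returns to
a very small section can be closed up, between a point and its first return, by a path in the
section; since the return is the first one, the result is a simple closed curve `c`, of period `t`
say (`IsLocalSection.ne_of_pos`). Its chords `c (u + s) - c u` are close to the displacements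
`φ s (c u) - c u`. The displacement field `φ s p - p` vanishes nowhere on the plane, hence has winding
number `0` along `c`. On the other hand `c (u + r) - c u` vanishes for no `r` in `(0, t)`, so the winding
number of the chords is the same for `r = s` as for `r = t / 2`; and there it is odd, since the chord
changes its sign under `u ↦ u + t / 2` (`exists_chord_div_notMem_slitPlane`). This argument covers
periodic flowlines too and does not use the Jordan curve theorem.
-/

open Set Metric

/-! ### Logarithms of plane-valued maps and chords of closed curves -/

/-- On a simply connected space, a nowhere vanishing complex function has a logarithm. -/
theorem exists_continuous_exp_eq {X : Type*} [TopologicalSpace X] [SimplyConnectedSpace X]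
    [LocallyPathConnectedSpace X] {g : X → ℂ} (hg : Continuous g) (h0 : ∀ x, g x ≠ 0) :
    ∃ L : X → ℂ, Continuous L ∧ ∀ x, Complex.exp (L x) = g x := by
  obtain ⟨x₀⟩ : Nonempty X := inferInstance
  obtain ⟨F, ⟨-, hF⟩, -⟩ := Complex.isCoveringMapOn_exp.existsUnique_continuousMap_lifts
    ⟨g, hg⟩ (Complex.exp_log (h0 x₀)) h0
  exact ⟨F, F.continuous, fun x => congrFun hF x⟩

theorem eq_of_exp_eq_const {X : Type*} [TopologicalSpace X] [PreconnectedSpace X] {h : X → ℂ}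
    (hh : Continuous h) {a : ℂ} (ha : ∀ x, Complex.exp (h x) = a) (x y : X) : h x = h y :=
  Complex.isCoveringMap_exp.const_of_comp hh (fun x y => Subtype.ext ((ha x).trans (ha y).symm)) x y

/-- The chords `c (u + s) - c u` of a simple closed curve `c` cannot all lie in the slit plane
relative to a loop `exp ∘ A` of winding number zero. Indeed the winding number of
`u ↦ c (u + r) - c u` does not depend on `r ∈ (0, T)`, and it is odd for `r = T / 2`, where the
chord changes its sign under `u ↦ u + T / 2`. -/
theorem exists_chord_div_notMem_slitPlane {c A : ℝ → ℂ} {T s : ℝ} (hs : 0 < s) (hsT : s < T)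
    (hc : Continuous c) (hcT : Function.Periodic c T)
    (hinj : ∀ u r, 0 < r → r < T → c (u + r) ≠ c u)
    (hA : Continuous A) (hAT : Function.Periodic A T) :
    ∃ u, (c (u + s) - c u) / Complex.exp (A u) ∉ Complex.slitPlane := by
  by_contra! hslit
  have hT : 0 < T := hs.trans hsT
  -- The parameter span of the chord, moving from `s` at `q = 0` to `T / 2` at `q = 1`.
  let ρ : ℝ → ℝ := fun q => s + (max 0 (min 1 q)) * (T / 2 - s)
  have hρ : Continuous ρ := by fun_prop
  have hρ0 : ∀ q, 0 < ρ q ∧ ρ q < T := by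
    intro q
    have h1 : 0 ≤ max 0 (min 1 q) := le_max_left _ _
    have h2 : max 0 (min 1 q) ≤ 1 := max_le zero_le_one (min_le_left _ _)
    simp only [ρ]
    generalize max 0 (min 1 q) = w at h1 h2
    constructor <;> nlinarith
  obtain ⟨L, hL, hLe⟩ := exists_continuous_exp_eq (X := ℝ × ℝ)
    (g := fun z => c (z.1 + ρ z.2) - c z.1) (by fun_prop)
    (fun z => sub_ne_zero.2 (hinj _ _ (hρ0 _).1 (hρ0 _).2))
  have hρs : ρ 0 = s := by simp [ρ]
  have hρT : ρ 1 = T / 2 := by simp [ρ]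
  -- The increment of the logarithm over one period is independent of the span.
  have hk : L (0 + T, 0) - L (0, 0) = L (0 + T, 1) - L (0, 1) := by
    refine eq_of_exp_eq_const (X := ℝ) (h := fun q => L (0 + T, q) - L (0, q)) (a := 1)
      (by fun_prop) (fun q => ?_) 0 1
    have h1 : c (0 + T + ρ q) = c (0 + ρ q) := by rw [add_right_comm, hcT]
    have h2 := hinj 0 _ (hρ0 q).1 (hρ0 q).2
    rw [Complex.exp_sub, hLe, hLe]
    simp only [h1, hcT 0]
    exact div_self (sub_ne_zero.2 h2)
  -- For the span `s` it vanishes.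
  have hzero : L (0 + T, 0) - L (0, 0) = 0 := by
    have hlogc : Continuous fun u => Complex.log ((c (u + s) - c u) / Complex.exp (A u)) :=
      Continuous.clog (by
        refine Continuous.div (by fun_prop) (by fun_prop) fun u => Complex.exp_ne_zero _) hslit
    have := eq_of_exp_eq_const (X := ℝ) (h := fun u => L (u, 0) - A u -
      Complex.log ((c (u + s) - c u) / Complex.exp (A u))) (a := 1)
      (by fun_prop) (fun u => by
        have h2 : c (u + s) - c u ≠ 0 := sub_ne_zero.2 (hinj u s hs hsT)
        rw [Complex.exp_sub, Complex.exp_sub, hLe, Complex.exp_log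
          (Complex.slitPlane_ne_zero (hslit u))]
        simp only [hρs]
        exact div_self (div_ne_zero h2 (Complex.exp_ne_zero _))) (0 + T) 0
    have h1 : c (0 + T + s) = c (0 + s) := by rw [add_right_comm, hcT]
    simp only [h1, hcT 0, hAT 0] at this
    linear_combination this
  -- For the span `T / 2` it is twice the increment over half a period.
  have hhalf := eq_of_exp_eq_const (X := ℝ) (h := fun u => L (u + T / 2, 1) - L (u, 1))
      (a := -1) (by fun_prop) (fun u => by
        have h2 : c (u + T / 2) - c u ≠ 0 :=
          sub_ne_zero.2 (hinj u (T / 2) (by linarith) (by linarith))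
        have h3 : c (u + T / 2 + T / 2) = c u := by rw [add_assoc, add_halves, hcT]
        rw [Complex.exp_sub, hLe, hLe]
        simp only [hρT, h3]
        rw [div_eq_iff h2]
        ring) (0 + T / 2) 0
  have hexp : Complex.exp (L (0 + T / 2, 1) - L (0, 1)) = -1 := by
    have h2 : c (0 + T / 2) - c 0 ≠ 0 :=
      sub_ne_zero.2 (hinj 0 (T / 2) (by linarith) (by linarith))
    have h3 : c (0 + T / 2 + T / 2) = c 0 := by rw [add_assoc, add_halves, hcT]
    rw [Complex.exp_sub, hLe, hLe]
    simp only [hρT, h3]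
    rw [div_eq_iff h2]
    ring
  simp only [add_assoc, add_halves] at hhalf
  have : L (0 + T / 2, 1) - L (0, 1) = 0 := by
    linear_combination (1 / 2 : ℂ) * hzero - (1 / 2 : ℂ) * hk - (1 / 2 : ℂ) * hhalf
  rw [this, Complex.exp_zero] at hexp
  norm_num at hexp

/-! ### Local sections of a flow -/

/-- `p ↦ φ (τ p) p` is a projection of the ball of radius `ε` around `x` along the flowlines to a
local section through `x`: by continuous times `τ`, onto a set that a flowline leaving it does not
meet again for a time `δ`. -/
structure IsLocalSection (φ : Flow ℝ Plane) (x : Plane) (ε δ : ℝ) (τ : Plane → ℝ) : Prop where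
  radius_pos : 0 < ε
  time_pos : 0 < δ
  continuousOn : ContinuousOn τ (closedBall x ε)
  apply_center : τ x = 0
  separated : ∀ p ∈ closedBall x ε, ∀ q ∈ closedBall x ε, ∀ u, |u| ≤ δ →
    φ u (φ (τ p) p) = φ (τ q) q → u = 0

theorem IsLocalSection.mono {φ : Flow ℝ Plane} {x : Plane} {ε ε' δ : ℝ} {τ : Plane → ℝ}
    (h : IsLocalSection φ x ε δ τ) (h0 : 0 < ε') (hε : ε' ≤ ε) : IsLocalSection φ x ε' δ τ :=
  ⟨h0, h.time_pos, h.continuousOn.mono (closedBall_subset_closedBall hε), h.apply_center,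
    fun p hp q hq => h.separated p (closedBall_subset_closedBall hε hp) q
      (closedBall_subset_closedBall hε hq)⟩

theorem Flow.continuous_uncurry (φ : Flow ℝ Plane) : Continuous fun z : ℝ × Plane => φ z.1 z.2 :=
  φ.continuous continuous_fst continuous_snd

/-- Near a point that a flow moves there is a continuous function of time and position which
strictly increases in time and depends only on the position reached. -/
theorem Flow.exists_strictMonoOn_near (φ : Flow ℝ Plane) {x : Plane} {a : ℝ} (ha : φ a x ≠ x) :
    ∃ (g : Plane → ℝ) (ε δ : ℝ), 0 < ε ∧ 0 < δ ∧ Continuous g ∧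
      ∀ p ∈ closedBall x ε, StrictMonoOn (fun t => g (φ t p)) (Icc (-(2 * δ)) (2 * δ)) := by
  have hφ := φ.continuous_uncurry
  -- Averaging a linear functional over the time `a` makes it differentiable along the flow; the
  -- derivative is the increment of the functional over the time `a`, positive at `x`.
  let θ : Plane → ℝ := fun p => inner ℝ (φ a x - x) p
  have hθ : Continuous θ := by fun_prop
  let g : Plane → ℝ := fun p => ∫ u in (0 : ℝ)..a, θ (φ u p)
  have hg : Continuous g := by
    refine intervalIntegral.continuous_parametric_intervalIntegral_of_continuous' ?_ 0 a
    exact hθ.comp (φ.continuous continuous_snd continuous_fst)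
  have hk : ∀ p, Continuous fun u => θ (φ u p) := fun p =>
    hθ.comp (φ.continuous continuous_id continuous_const)
  have hgt : ∀ t p, g (φ t p) = ∫ u in t..(a + t), θ (φ u p) := by
    intro t p
    have := intervalIntegral.integral_comp_add_right (a := 0) (b := a) (fun u => θ (φ u p)) t
    simp only [zero_add] at this
    rw [← this]
    simp only [g, φ.map_add]
  have hdiff : ∀ t t' p, g (φ t' p) - g (φ t p) =
      ∫ u in t..t', (θ (φ (u + a) p) - θ (φ u p)) := by
    intro t t' p
    have hint : ∀ b b', IntervalIntegrable (fun u => θ (φ u p)) MeasureTheory.volume b b' :=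
      fun b b' => (hk p).intervalIntegrable b b'
    have hint' : IntervalIntegrable (fun u => θ (φ (u + a) p)) MeasureTheory.volume t t' :=
      ((hk p).comp (continuous_add_const a)).intervalIntegrable _ _
    rw [intervalIntegral.integral_sub hint' (hint _ _),
      intervalIntegral.integral_comp_add_right (fun u => θ (φ u p)) a, hgt, hgt,
      intervalIntegral.integral_interval_sub_interval_comm (hint _ _) (hint _ _) (hint _ _),
      add_comm a t', add_comm a t]
    rw [intervalIntegral.integral_symm t t', intervalIntegral.integral_symm (t + a) (t' + a)]
    ring
  -- The derivative stays positive for positions near `x` and small times.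
  have hpos : ∀ᶠ z : ℝ × Plane in nhds (0, x), 0 < θ (φ (z.1 + a) z.2) - θ (φ z.1 z.2) := by
    have hc : Continuous fun z : ℝ × Plane => θ (φ (z.1 + a) z.2) - θ (φ z.1 z.2) :=
      (hθ.comp (φ.continuous (continuous_fst.add continuous_const) continuous_snd)).sub
        (hθ.comp hφ)
    refine continuousAt_const.eventually_lt hc.continuousAt ?_
    simp only [zero_add, φ.map_zero_apply, θ]
    rw [← inner_sub_right]
    exact real_inner_self_pos.2 (sub_ne_zero.2 ha)
  obtain ⟨r, hr, hball⟩ := Metric.eventually_nhds_iff_ball.1 hpos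
  refine ⟨g, r / 2, r / 8, by positivity, by positivity, hg, fun p hp t ht t' ht' htt => ?_⟩
  rw [← sub_pos, hdiff]
  refine intervalIntegral.intervalIntegral_pos_of_pos_on
    ((((hk p).comp (continuous_add_const a)).sub (hk p)).intervalIntegrable _ _) ?_ htt
  intro u hu
  refine hball (u, p) ?_
  rw [mem_ball, Prod.dist_eq, max_lt_iff]
  refine ⟨?_, lt_of_le_of_lt (mem_closedBall.1 hp) (by linarith)⟩
  rw [Real.dist_eq, abs_lt]
  constructor <;> linarith [hu.1, hu.2, ht.1, ht'.2]

/-- A flow has a local section through each point that is not fixed. -/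
theorem Flow.exists_isLocalSection (φ : Flow ℝ Plane) {x : Plane} {a : ℝ} (ha : φ a x ≠ x) :
    ∃ ε δ τ, IsLocalSection φ x ε δ τ := by
  obtain ⟨g, ε₁, δ, hε₁, hδ, hg, hmono⟩ := φ.exists_strictMonoOn_near ha
  have hgc : ∀ t, Continuous fun p => g (φ t p) := fun t =>
    hg.comp (φ.continuous continuous_const continuous_id)
  have hx := hmono x (mem_closedBall_self hε₁.le)
  have hlo : ∀ᶠ p in nhds x, g (φ (-δ) p) < g x := by
    refine (hgc (-δ)).continuousAt.eventually_lt continuousAt_const ?_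
    simpa using hx (a := -δ) (b := 0) ⟨by linarith, by linarith⟩ ⟨by linarith, by linarith⟩
      (by linarith)
  have hhi : ∀ᶠ p in nhds x, g x < g (φ δ p) := by
    refine continuousAt_const.eventually_lt (hgc δ).continuousAt ?_
    simpa using hx (a := 0) (b := δ) ⟨by linarith, by linarith⟩ ⟨by linarith, by linarith⟩
      (by linarith)
  obtain ⟨ε₂, hε₂, hball⟩ := Metric.nhds_basis_closedBall.eventually_iff.1 (hlo.and hhi)
  let ε := min ε₁ ε₂
  have hε : 0 < ε := lt_min hε₁ hε₂
  have hsub : ∀ p ∈ closedBall x ε,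
      StrictMonoOn (fun t => g (φ t p)) (Icc (-(2 * δ)) (2 * δ)) := fun p hp =>
    hmono p (closedBall_subset_closedBall (min_le_left _ _) hp)
  have hex : ∀ p, ∃ t, p ∈ closedBall x ε → t ∈ Icc (-δ) δ ∧ g (φ t p) = g x := by
    intro p
    by_cases hp : p ∈ closedBall x ε
    · obtain ⟨h1, h2⟩ := hball (closedBall_subset_closedBall (min_le_right _ _) hp)
      obtain ⟨t, ht, hgt⟩ := intermediate_value_Icc (by linarith : -δ ≤ δ)
        (f := fun t => g (φ t p))
        (hg.comp (φ.continuous continuous_id continuous_const)).continuousOn ⟨h1.le, h2.le⟩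
      exact ⟨t, fun _ => ⟨ht, hgt⟩⟩
    · exact ⟨0, fun h => absurd h hp⟩
  choose τ hτ using hex
  refine ⟨ε, δ, τ, hε, hδ, ?_, ?_, ?_⟩
  · intro p hp
    refine Metric.tendsto_nhds.2 fun η hη => ?_
    let κ := min η δ
    have hκ : 0 < κ := lt_min hη hδ
    have hκδ : κ ≤ δ := min_le_right _ _
    obtain ⟨hτp, hgp⟩ := hτ p hp
    have h1 : g (φ (τ p - κ) p) < g x := hgp ▸ hsub p hp
      ⟨by linarith [hτp.1], by linarith [hτp.2]⟩ ⟨by linarith [hτp.1], by linarith [hτp.2]⟩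
      (by linarith)
    have h2 : g x < g (φ (τ p + κ) p) := hgp ▸ hsub p hp
      ⟨by linarith [hτp.1], by linarith [hτp.2]⟩ ⟨by linarith [hτp.1], by linarith [hτp.2]⟩
      (by linarith)
    have h1' := (hgc (τ p - κ)).continuousAt.eventually_lt continuousAt_const h1
    have h2' := continuousAt_const.eventually_lt (hgc (τ p + κ)).continuousAt h2
    filter_upwards [self_mem_nhdsWithin, h1'.filter_mono nhdsWithin_le_nhds,
      h2'.filter_mono nhdsWithin_le_nhds] with q hq hq1 hq2
    obtain ⟨hτq, hgq⟩ := hτ q hq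
    rw [← hgq] at hq1 hq2
    have h3 := ((hsub q hq).lt_iff_lt ⟨by linarith [hτp.1], by linarith [hτp.2]⟩
      ⟨by linarith [hτq.1], by linarith [hτq.2]⟩).1 hq1
    have h4 := ((hsub q hq).lt_iff_lt ⟨by linarith [hτq.1], by linarith [hτq.2]⟩
      ⟨by linarith [hτp.1], by linarith [hτp.2]⟩).1 hq2
    rw [Real.dist_eq, abs_lt]
    have := min_le_left η δ
    constructor <;> linarith
  · have hxx := mem_closedBall_self (x := x) hε.le
    obtain ⟨h1, h2⟩ := hτ x hxx
    refine (hsub x hxx).injOn ⟨by linarith [h1.1], by linarith [h1.2]⟩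
      ⟨by linarith, by linarith⟩ ?_
    simpa using h2
  · intro p hp q hq u hu h
    obtain ⟨h1, h2⟩ := hτ p hp
    obtain ⟨hu1, hu2⟩ := abs_le.1 hu
    have h3 : g (φ (u + τ p) p) = g (φ (τ p) p) := by
      rw [φ.map_add, h, (hτ q hq).2, h2]
    have := (hsub p hp).injOn ⟨by linarith [h1.1], by linarith [h1.2]⟩
      ⟨by linarith [h1.1], by linarith [h1.2]⟩ h3
    linarith

/-! ### Flowlines do not return to small local sections -/

theorem Flow.map_nat_mul_of_map_eq (φ : Flow ℝ Plane) {s : ℝ} {p : Plane} (h : φ s p = p) (n : ℕ) :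
    φ (n * s) p = p := by
  induction n with
  | zero => simp
  | succ n ih => rw [Nat.cast_succ, add_one_mul, φ.map_add, h, ih]

theorem Flow.map_sub_eq_of_map_eq (φ : Flow ℝ Plane) {a b : ℝ} {p q : Plane}
    (h : φ a p = φ b q) : φ (b - a) q = p := by
  rw [sub_eq_neg_add, φ.map_add, ← h, ← φ.map_add, neg_add_cancel, φ.map_zero_apply]

/-- The displacements of a fixed point free map of the plane along a loop have winding number zero,
so they cannot be close to the chords of a simple closed curve. -/
theorem exists_norm_sub_le_norm_chord_sub {F : Plane → Plane} (hF : Continuous F)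
    (hfix : ∀ p, F p ≠ p) {c : ℝ → Plane} {T s : ℝ} (hs : 0 < s) (hsT : s < T)
    (hc : Continuous c) (hcT : Function.Periodic c T)
    (hinj : ∀ u r, 0 < r → r < T → c (u + r) ≠ c u) :
    ∃ u, ‖F (c u) - c u‖ ≤ ‖c (u + s) - F (c u)‖ := by
  by_contra! hlt
  let e : Plane ≃ₗᵢ[ℝ] ℂ := Complex.orthonormalBasisOneI.repr.symm
  obtain ⟨L, hL, hLe⟩ := exists_continuous_exp_eq (g := fun p => e (F p - p)) (by fun_prop)
    (fun p => (map_ne_zero_iff e e.injective).2 (sub_ne_zero.2 (hfix p)))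
  obtain ⟨u, hu⟩ := exists_chord_div_notMem_slitPlane (c := fun u => e (c u))
    (A := fun u => L (c u)) hs hsT (by fun_prop) (fun u => by simp only [hcT u])
    (fun u r h0 h1 h => hinj u r h0 h1 (e.injective h)) (by fun_prop)
    (fun u => by simp only [hcT u])
  refine hu ?_
  have h0 : e (F (c u) - c u) ≠ 0 := (map_ne_zero_iff e e.injective).2 (sub_ne_zero.2 (hfix (c u)))
  have hsplit : (e (c (u + s)) - e (c u)) / Complex.exp (L (c u)) =
      1 + e (c (u + s) - F (c u)) / e (F (c u) - c u) := by
    rw [hLe, ← div_self h0, ← add_div, ← map_add, ← map_sub]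
    congr 2
    abel
  rw [hsplit]
  refine Complex.mem_slitPlane_of_norm_lt_one ?_
  rw [norm_div, div_lt_one (norm_pos_iff.2 h0), e.norm_map, e.norm_map]
  exact hlt u

/-- On a small enough local section, two points stay closer to each other under the flow, for a
bounded time, than the distance by which a fixed point free time-`s` map moves them. -/
theorem IsLocalSection.exists_radius {φ : Flow ℝ Plane} {x : Plane} {ε δ : ℝ} {τ : Plane → ℝ}
    (h : IsLocalSection φ x ε δ τ) {s : ℝ} (hs : ∀ p, φ s p ≠ p) :
    ∃ ε', 0 < ε' ∧ ε' ≤ ε ∧ ∀ p ∈ closedBall x ε', ∀ q ∈ closedBall x ε', ∀ w ∈ Icc (-(2 * δ)) 0,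
      ‖φ (w + s) (φ (τ q) q) - φ (w + s) (φ (τ p) p)‖ <
        ‖φ (w + s) (φ (τ p) p) - φ w (φ (τ p) p)‖ := by
  have hnear : ∀ᶠ z : Plane × Plane in nhds (x, x), ∀ w ∈ Icc (-(2 * δ)) 0,
      ‖φ (w + s) z.2 - φ (w + s) z.1‖ < ‖φ (w + s) z.1 - φ w z.1‖ := by
    refine isCompact_Icc.eventually_forall_of_forall_eventually fun w _ => ?_
    have h1 : Continuous fun z : (Plane × Plane) × ℝ => ‖φ (z.2 + s) z.1.2 - φ (z.2 + s) z.1.1‖ :=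
      ((φ.continuous (by fun_prop) (by fun_prop)).sub
        (φ.continuous (by fun_prop) (by fun_prop))).norm
    have h2 : Continuous fun z : (Plane × Plane) × ℝ => ‖φ (z.2 + s) z.1.1 - φ z.2 z.1.1‖ :=
      ((φ.continuous (by fun_prop) (by fun_prop)).sub
        (φ.continuous (by fun_prop) (by fun_prop))).norm
    refine h1.continuousAt.eventually_lt h2.continuousAt ?_
    simp only [sub_self, norm_zero]
    rw [add_comm, φ.map_add]
    exact norm_pos_iff.2 (sub_ne_zero.2 (hs _))
  have hτ : ContinuousAt τ x := h.continuousOn.continuousAt (closedBall_mem_nhds x h.radius_pos)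
  have hπ : ContinuousAt (fun p => φ (τ p) p) x :=
    φ.continuous_uncurry.continuousAt.comp (hτ.prodMk continuousAt_id)
  have hx : φ (τ x) x = x := by rw [h.apply_center, φ.map_zero_apply]
  have hππ : Filter.Tendsto (fun z : Plane × Plane => (φ (τ z.1) z.1, φ (τ z.2) z.2))
      (nhds x ×ˢ nhds x) (nhds (x, x)) := by
    rw [nhds_prod_eq]
    exact Filter.Tendsto.prodMap (hx ▸ hπ.tendsto) (hx ▸ hπ.tendsto)
  obtain ⟨r, hr, hball⟩ := (Metric.nhds_basis_closedBall.prod_self).eventually_iff.1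
    (hππ.eventually hnear)
  refine ⟨min r ε, lt_min hr h.radius_pos, min_le_right _ _, fun p hp q hq w hw => ?_⟩
  exact hball (x := (p, q)) ⟨closedBall_subset_closedBall (min_le_left _ _) hp,
    closedBall_subset_closedBall (min_le_left _ _) hq⟩ w hw

/-- If a flowline returns to a compact local section, then there is a first return. -/
theorem IsLocalSection.exists_first_return {φ : Flow ℝ Plane} {x : Plane} {ε δ : ℝ} {τ : Plane → ℝ}
    (h : IsLocalSection φ x ε δ τ) {p : Plane} (hp : p ∈ closedBall x ε) {u : ℝ} (hu : 0 < u)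
    (hret : ∃ q ∈ closedBall x ε, φ u (φ (τ p) p) = φ (τ q) q) :
    ∃ t, δ ≤ t ∧ (∃ q ∈ closedBall x ε, φ t (φ (τ p) p) = φ (τ q) q) ∧
      ∀ v, 0 < v → v < t → ∀ q ∈ closedBall x ε, φ v (φ (τ p) p) ≠ φ (τ q) q := by
  have hδ := h.time_pos
  have hle : ∀ v, 0 < v → (∃ q ∈ closedBall x ε, φ v (φ (τ p) p) = φ (τ q) q) → δ ≤ v := by
    rintro v hv ⟨q, hq, hvq⟩
    by_contra! hlt
    exact hv.ne' (h.separated p hp q hq v (by rw [abs_of_pos hv]; exact hlt.le) hvq)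
  let S : Set Plane := (fun q => φ (τ q) q) '' closedBall x ε
  have hS : IsClosed S := by
    refine ((isCompact_closedBall x ε).image_of_continuousOn ?_).isClosed
    exact φ.continuous_uncurry.comp_continuousOn (h.continuousOn.prodMk continuousOn_id)
  let R : Set ℝ := Ici δ ∩ (fun v => φ v (φ (τ p) p)) ⁻¹' S
  have hR : IsClosed R :=
    isClosed_Ici.inter (hS.preimage (φ.continuous continuous_id continuous_const))
  have hmem : ∀ v, 0 < v → (∃ q ∈ closedBall x ε, φ v (φ (τ p) p) = φ (τ q) q) → v ∈ R := by
    rintro v hv hvq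
    refine ⟨hle v hv hvq, ?_⟩
    obtain ⟨q, hq, hvq⟩ := hvq
    exact ⟨q, hq, hvq.symm⟩
  have hbdd : BddBelow R := ⟨δ, fun v hv => hv.1⟩
  obtain ⟨ht, q, hq, hqt⟩ := hR.csInf_mem ⟨u, hmem u hu hret⟩ hbdd
  exact ⟨sInf R, ht, ⟨q, hq, hqt.symm⟩, fun v hv hvt q hq hvq =>
    (csInf_le hbdd (hmem v hv ⟨q, hq, hvq⟩)).not_gt hvt⟩

/-- A flowline that returned to a small local section could be closed up, from its first return
on, within the section. The resulting simple closed curve would have its chords close to the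
displacements of the fixed point free time-`s` map. -/
theorem IsLocalSection.ne_of_pos {φ : Flow ℝ Plane} {x : Plane} {ε δ : ℝ} {τ : Plane → ℝ}
    (h : IsLocalSection φ x ε δ τ) {s : ℝ} (hs0 : 0 < s) (hsδ : s ≤ δ / 2)
    (hs : ∀ p, φ s p ≠ p)
    (hclose : ∀ p ∈ closedBall x ε, ∀ q ∈ closedBall x ε, ∀ w ∈ Icc (-(2 * δ)) 0,
      ‖φ (w + s) (φ (τ q) q) - φ (w + s) (φ (τ p) p)‖ <
        ‖φ (w + s) (φ (τ p) p) - φ w (φ (τ p) p)‖)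
    {p q : Plane} (hp : p ∈ closedBall x ε) (hq : q ∈ closedBall x ε) {u : ℝ} (hu : 0 < u) :
    φ u (φ (τ p) p) ≠ φ (τ q) q := by
  intro hret
  have hδ := h.time_pos
  obtain ⟨t, hδt, ⟨p₁, hp₁, htp⟩, hfirst⟩ := h.exists_first_return hp hu ⟨q, hq, hret⟩
  clear hret hu u hq q
  have ht : 0 < t := hδ.trans_le hδt
  -- `P u` is the point whose projection to the section is followed at time `u`: the return point
  -- `p₁`, except that during the last time `δ / 2` it moves to `p` along a segment.
  let lam : ℝ → ℝ := fun u => max 0 (1 - (t - u) / (δ / 2))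
  have hlam : Continuous lam := by fun_prop
  have hlam0 : ∀ u, u ≤ t - δ / 2 → lam u = 0 := by
    intro u hu
    refine max_eq_left ?_
    rw [sub_nonpos, one_le_div (by positivity)]
    linarith
  have hlam1 : lam t = 1 := by simp [lam]
  let P : ℝ → Plane := fun u => p₁ + lam u • (p - p₁)
  have hPc : Continuous P := by fun_prop
  have hP : ∀ u, u ≤ t → P u ∈ closedBall x ε := by
    intro u hu
    refine (convex_closedBall x ε).add_smul_sub_mem hp₁ hp ⟨le_max_left _ _, ?_⟩
    refine max_le zero_le_one (sub_le_self _ (div_nonneg (sub_nonneg.2 hu) (by positivity)))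
  have hP0 : ∀ u, u ≤ t - δ / 2 → P u = p₁ := fun u hu => by simp [P, hlam0 u hu]
  have hP1 : P t = p := by simp [P, hlam1]
  let c₀ : ℝ → Plane := fun u => φ (u - t) (φ (τ (P u)) (P u))
  have hc₀c : ContinuousOn c₀ (Icc 0 t) := by
    refine φ.continuous_uncurry.comp_continuousOn (ContinuousOn.prodMk (by fun_prop) ?_)
    refine φ.continuous_uncurry.comp_continuousOn (ContinuousOn.prodMk ?_ hPc.continuousOn)
    exact h.continuousOn.comp hPc.continuousOn fun u hu => hP u hu.2
  have hc₀0 : ∀ u, u ≤ t - δ / 2 → c₀ u = φ u (φ (τ p) p) := by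
    intro u hu
    simp only [c₀, hP0 u hu]
    rw [← htp, ← φ.map_add (u - t) t, sub_add_cancel]
  have hc₀t : c₀ t = φ (τ p) p := by simp [c₀, hP1, φ.map_zero_apply]
  have hc₀z : c₀ 0 = φ (τ p) p := by rw [hc₀0 0 (by linarith), φ.map_zero_apply]
  -- Two equal values of `c₀` either are close in time, against the separation of the section, or
  -- give a point of the flowline of `p` in the section before the first return.
  have hinj₀ : ∀ u u', 0 ≤ u → u < u' → u' ≤ t → c₀ u = c₀ u' → u = 0 ∧ u' = t := by
    intro u u' hu huu hu' heq
    have hmove : φ (u' - u) (φ (τ (P u')) (P u')) = φ (τ (P u)) (P u) := by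
      have := φ.map_sub_eq_of_map_eq heq
      rwa [sub_sub_sub_cancel_right] at this
    by_cases hsmall : u' - u ≤ δ
    · have := h.separated _ (hP u' hu') _ (hP u (by linarith)) (u' - u)
        (by rwa [abs_of_pos (by linarith)]) hmove
      linarith
    · rw [hP0 u (by linarith), ← htp] at hmove
      have hback : φ (u + t - u') (φ (τ p) p) = φ (τ (P u')) (P u') := by
        rw [← φ.map_sub_eq_of_map_eq hmove]
        congr 1
        ring
      rcases (show 0 ≤ u + t - u' by linarith).eq_or_lt with h0 | h0
      · constructor <;> linarith
      · exact absurd hback (hfirst _ h0 (by linarith) _ (hP u' hu'))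
  have : Fact (0 < t) := ⟨ht⟩
  -- The periodic extension of `c₀`.
  let c : ℝ → Plane := fun u => AddCircle.liftIco t 0 c₀ (u : AddCircle t)
  have hc : Continuous c := by
    refine (AddCircle.liftIco_continuous (a := 0) (f := c₀) ?_ ?_).comp (AddCircle.continuous_mk' t)
    · rw [zero_add, hc₀z, hc₀t]
    · rwa [zero_add]
  have hcT : Function.Periodic c t := fun u => by simp only [c, AddCircle.coe_add_period]
  have hcc₀ : ∀ u, 0 ≤ u → u ≤ t → c u = c₀ u := by
    intro u hu hut
    rcases hut.eq_or_lt with rfl | hlt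
    · rw [← zero_add u, hcT 0, zero_add, hc₀t, ← hc₀z]
      exact AddCircle.liftIco_zero_coe_apply ⟨le_rfl, ht⟩
    · exact AddCircle.liftIco_zero_coe_apply ⟨hu, hlt⟩
  have hcsub : ∀ u, c u = c (u - t) := fun u => by rw [← hcT (u - t), sub_add_cancel]
  have hinj : ∀ u r, 0 < r → r < t → c (u + r) ≠ c u := by
    intro u r hr hrt
    obtain ⟨n, ⟨hn0, hn1⟩, -⟩ := existsUnique_sub_zsmul_mem_Ico ht u 0
    rw [zero_add] at hn1
    have hper : ∀ v, c (v - n • t) = c v := fun v => hcT.sub_zsmul_eq n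
    rw [← hper u, ← hper (u + r), add_sub_right_comm]
    generalize u - n • t = v at hn0 hn1
    intro heq
    by_cases hvr : v + r ≤ t
    · rw [hcc₀ _ (by linarith) hvr, hcc₀ _ hn0 hn1.le] at heq
      obtain ⟨h0, h1⟩ := hinj₀ v (v + r) hn0 (by linarith) hvr heq.symm
      linarith
    · rw [hcsub (v + r), hcc₀ (v + r - t) (by linarith) (by linarith), hcc₀ _ hn0 hn1.le] at heq
      obtain ⟨h0, h1⟩ := hinj₀ (v + r - t) v (by linarith) (by linarith) hn1.le heq
      linarith
  obtain ⟨u, hu⟩ := exists_norm_sub_le_norm_chord_sub (F := φ s)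
    (φ.continuous continuous_const continuous_id) hs hs0 (by linarith) hc hcT hinj
  obtain ⟨n, ⟨hn0, hn1⟩, -⟩ := existsUnique_sub_zsmul_mem_Ico ht u 0
  rw [zero_add] at hn1
  have hper : ∀ v, c (v - n • t) = c v := fun v => hcT.sub_zsmul_eq n
  rw [← hper u, ← hper (u + s), add_sub_right_comm] at hu
  generalize u - n • t = v at hn0 hn1 hu
  -- The chord equals the displacement until the curve leaves the flowline of `p`; from then on all
  -- points involved are on flow arcs of bounded length through the section.
  refine hu.not_gt ?_
  rw [hcc₀ v hn0 hn1.le]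
  by_cases hvs : v + s ≤ t - δ / 2
  · rw [hcc₀ (v + s) (by linarith) (by linarith), hc₀0 _ hvs, hc₀0 v (by linarith), add_comm v s,
      φ.map_add, sub_self, norm_zero]
    exact norm_pos_iff.2 (sub_ne_zero.2 (hs _))
  · have hφs : φ s (c₀ v) = φ (v - t + s) (φ (τ (P v)) (P v)) := by
      simp only [c₀]
      rw [← φ.map_add s (v - t), add_comm]
    obtain ⟨q, hq, hcq⟩ : ∃ q ∈ closedBall x ε, c (v + s) = φ (v - t + s) (φ (τ q) q) := by
      by_cases hvt : v + s ≤ t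
      · refine ⟨P (v + s), hP _ hvt, ?_⟩
        rw [hcc₀ _ (by linarith) hvt]
        simp only [c₀]
        congr 1
        ring
      · refine ⟨p, hp, ?_⟩
        rw [hcsub, hcc₀ _ (by linarith) (by linarith), hc₀0 _ (by linarith)]
        congr 1
        ring
    rw [hφs, hcq]
    exact hclose _ (hP v hn1.le) q hq (v - t) ⟨by linarith, by linarith⟩

/-- If the time-one map of a flow on the plane is fixed point free, then through each point there is
a local section that every flowline meets at most once. -/
theorem Flow.exists_isLocalSection_eq_zero (φ : Flow ℝ Plane) (hφ : ∀ p, φ 1 p ≠ p) (x : Plane) :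
    ∃ ε δ τ, IsLocalSection φ x ε δ τ ∧ ∀ p ∈ closedBall x ε, ∀ q ∈ closedBall x ε, ∀ u,
      φ u (φ (τ p) p) = φ (τ q) q → u = 0 := by
  obtain ⟨ε, δ, τ, h⟩ := φ.exists_isLocalSection (hφ x)
  have hδ := h.time_pos
  obtain ⟨n, hn⟩ := exists_nat_one_div_lt (half_pos hδ)
  have hs : ∀ p, φ (1 / ((n : ℝ) + 1)) p ≠ p := by
    intro p hp
    have := φ.map_nat_mul_of_map_eq hp (n + 1)
    rw [Nat.cast_succ, mul_one_div_cancel (by positivity)] at this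
    exact hφ p this
  obtain ⟨ε', hε', hle, hclose⟩ := h.exists_radius hs
  have h' := h.mono hε' hle
  have hpos : ∀ p ∈ closedBall x ε', ∀ q ∈ closedBall x ε', ∀ u, 0 < u →
      φ u (φ (τ p) p) ≠ φ (τ q) q := fun p hp q hq u hu =>
    h'.ne_of_pos (by positivity) hn.le hs hclose hp hq hu
  refine ⟨ε', δ, τ, h', fun p hp q hq u huq => ?_⟩
  rcases lt_trichotomy u 0 with hu | hu | hu
  · refine absurd ?_ (hpos q hq p hp (-u) (neg_pos.2 hu))
    rw [← huq, ← φ.map_add, neg_add_cancel, φ.map_zero_apply]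
  · exact hu
  · exact absurd huq (hpos p hp q hq u hu)

/-! ### The time coordinate along the flowlines -/

/-- Every point has an open neighborhood that is a union of flowlines and carries a continuous
function increasing at unit speed along the flow: the time since the crossing of a local section
that every flowline meets at most once. -/
theorem Flow.exists_time_coordinate (φ : Flow ℝ Plane) (hφ : ∀ p, φ 1 p ≠ p) (x : Plane) :
    ∃ (W : Set Plane) (T : Plane → ℝ), IsOpen W ∧ x ∈ W ∧ (∀ t, ∀ y ∈ W, φ t y ∈ W) ∧
      ContinuousOn T W ∧ ∀ y ∈ W, ∀ t, T (φ t y) = T y + t := by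
  obtain ⟨ε, δ, τ, h, honce⟩ := φ.exists_isLocalSection_eq_zero hφ x
  let W : Set Plane := {y | ∃ t, φ t y ∈ ball x ε}
  have hex : ∀ y, ∃ t, y ∈ W → φ t y ∈ ball x ε := by
    intro y
    by_cases hy : y ∈ W
    · exact hy.imp fun t ht _ => ht
    · exact ⟨0, fun h => absurd h hy⟩
  choose σ hσ using hex
  let T : Plane → ℝ := fun y => -(τ (φ (σ y) y) + σ y)
  -- The crossing time does not depend on the time chosen to reach the ball.
  have hT : ∀ y ∈ W, ∀ t, φ t y ∈ ball x ε → T y = -(τ (φ t y) + t) := by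
    intro y hy t ht
    have := honce _ (ball_subset_closedBall (hσ y hy)) _ (ball_subset_closedBall ht)
      (τ (φ t y) + t - (τ (φ (σ y) y) + σ y)) (by
        rw [← φ.map_add, ← φ.map_add, ← φ.map_add]
        congr 1
        ring)
    simp only [T]
    linarith
  have hinv : ∀ t, ∀ y ∈ W, φ t y ∈ W := by
    rintro t y ⟨s, hs⟩
    exact ⟨s - t, by rwa [← φ.map_add, sub_add_cancel]⟩
  refine ⟨W, T, ?_, ⟨0, by simpa [φ.map_zero_apply] using h.radius_pos⟩, hinv, ?_, ?_⟩
  · have : W = ⋃ t, φ t ⁻¹' ball x ε := by ext y; simp [W]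
    rw [this]
    exact isOpen_iUnion fun t => isOpen_ball.preimage (φ.continuous continuous_const continuous_id)
  · intro y hy
    have hφσ : Continuous fun z => φ (σ y) z := φ.continuous continuous_const continuous_id
    have hτ : ContinuousAt τ (φ (σ y) y) := h.continuousOn.continuousAt
      (mem_nhds_iff.2 ⟨_, ball_subset_closedBall, isOpen_ball, hσ y hy⟩)
    have hc : ContinuousAt (fun z => -(τ (φ (σ y) z) + σ y)) y :=
      ((ContinuousAt.comp (f := fun z => φ (σ y) z) hτ hφσ.continuousAt).add
        continuousAt_const).neg
    refine (hc.congr ?_).continuousWithinAt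
    filter_upwards [hφσ.continuousAt.preimage_mem_nhds (isOpen_ball.mem_nhds (hσ y hy))] with z hz
    exact (hT z ⟨_, hz⟩ _ hz).symm
  · intro y hy t
    have hmove : φ (σ y - t) (φ t y) = φ (σ y) y := by rw [← φ.map_add, sub_add_cancel]
    rw [hT (φ t y) (hinv t y hy) (σ y - t) (by rw [hmove]; exact hσ y hy), hmove]
    simp only [T]
    ring

/-! ### The orbit space over the leaf space -/

theorem IsEmbeddedIn.zpow_apply {f : Plane ≃ₜ Plane} {φ : Flow ℝ Plane} (h : IsEmbeddedIn f φ)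
    (n : ℤ) (x : Plane) : (f ^ n) x = φ n x := by
  induction n generalizing x with
  | zero => simp [φ.map_zero_apply]
  | succ n ih =>
    rw [zpow_add_one, Homeomorph.mul_apply, ih, ← h x, ← φ.map_add]
    push_cast
    rfl
  | pred n ih =>
    have hinv : f⁻¹ x = φ (-1) x := by
      apply f.injective
      rw [← h (φ (-1) x), ← φ.map_add, add_neg_cancel, φ.map_zero_apply]
      exact f.apply_symm_apply x
    rw [zpow_sub_one, Homeomorph.mul_apply, ih, hinv, ← φ.map_add]
    push_cast
    rfl

theorem OrbitSpace.mk_eq_mk {f : Plane ≃ₜ Plane} {φ : Flow ℝ Plane} (h : IsEmbeddedIn f φ)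
    {x y : Plane} : (⟦x⟧ : OrbitSpace f) = ⟦y⟧ ↔ ∃ n : ℤ, φ n x = y := by
  rw [Quotient.eq]
  exact exists_congr fun n => by rw [h.zpow_apply]

theorem LeafSpace.mk_eq_mk {φ : Flow ℝ Plane} {x y : Plane} :
    (⟦x⟧ : LeafSpace φ) = ⟦y⟧ ↔ ∃ t : ℝ, φ t x = y := by
  rw [Quotient.eq]
  constructor
  · intro (h : φ.orbit x = φ.orbit y)
    exact φ.mem_orbit_iff.1 (h ▸ φ.mem_orbit_self y)
  · rintro ⟨t, rfl⟩
    exact (flow_orbit_map φ t x).symm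

theorem OrbitSpace.isOpenQuotientMap_mk {f : Plane ≃ₜ Plane} {φ : Flow ℝ Plane}
    (h : IsEmbeddedIn f φ) :
    IsOpenQuotientMap (Quotient.mk (orbitSetoid f) : Plane → OrbitSpace f) := by
  refine ⟨Quotient.mk_surjective, continuous_quotient_mk', fun O hO => ?_⟩
  have : Quotient.mk (orbitSetoid f) ⁻¹' (Quotient.mk (orbitSetoid f) '' O) =
      ⋃ n : ℤ, φ n ⁻¹' O := by
    ext y
    simp only [mem_preimage, mem_image, mem_iUnion]
    constructor
    · rintro ⟨z, hz, hzy⟩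
      obtain ⟨n, rfl⟩ := (OrbitSpace.mk_eq_mk h).1 hzy.symm
      exact ⟨n, hz⟩
    · rintro ⟨n, hn⟩
      exact ⟨_, hn, ((OrbitSpace.mk_eq_mk h).2 ⟨n, rfl⟩).symm⟩
  change IsOpen (Quotient.mk (orbitSetoid f) ⁻¹' _)
  rw [this]
  exact isOpen_iUnion fun n => hO.preimage (φ.continuous continuous_const continuous_id)

theorem LeafSpace.isOpenQuotientMap_mk (φ : Flow ℝ Plane) :
    IsOpenQuotientMap (Quotient.mk (flowlineSetoid φ) : Plane → LeafSpace φ) := by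
  refine ⟨Quotient.mk_surjective, continuous_quotient_mk', fun O hO => ?_⟩
  have : Quotient.mk (flowlineSetoid φ) ⁻¹' (Quotient.mk (flowlineSetoid φ) '' O) =
      ⋃ t : ℝ, φ t ⁻¹' O := by
    ext y
    simp only [mem_preimage, mem_image, mem_iUnion]
    constructor
    · rintro ⟨z, hz, hzy⟩
      obtain ⟨t, rfl⟩ := LeafSpace.mk_eq_mk.1 hzy.symm
      exact ⟨t, hz⟩
    · rintro ⟨t, ht⟩
      exact ⟨_, ht, (LeafSpace.mk_eq_mk.2 ⟨t, rfl⟩).symm⟩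
  change IsOpen (Quotient.mk (flowlineSetoid φ) ⁻¹' _)
  rw [this]
  exact isOpen_iUnion fun t => hO.preimage (φ.continuous continuous_const continuous_id)

/-- A time coordinate on a union of flowlines trivializes the orbit space over it: the fiber
coordinate of an orbit is its time modulo `1`. -/
theorem exists_trivialization_of_time_coordinate {f : Plane ≃ₜ Plane} {φ : Flow ℝ Plane}
    (hφ : IsEmbeddedIn f φ) {W : Set Plane} {T : Plane → ℝ} (hW : IsOpen W)
    (hinv : ∀ t, ∀ y ∈ W, φ t y ∈ W) (hTc : ContinuousOn T W)
    (hT : ∀ y ∈ W, ∀ t, T (φ t y) = T y + t) :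
    ∃ e : Bundle.Trivialization Circle (orbitToLeaf hφ),
      e.baseSet = Quotient.mk (flowlineSetoid φ) '' W := by
  have hq₁ := OrbitSpace.isOpenQuotientMap_mk hφ
  have hq₂ := LeafSpace.isOpenQuotientMap_mk φ
  have hq₃ : IsOpenQuotientMap Circle.exp :=
    ⟨Circle.exp_surjective, Circle.exp.continuous, isLocalHomeomorph_circleExp.isOpenMap⟩
  have hp : ∀ y, orbitToLeaf hφ ⟦y⟧ = ⟦y⟧ := fun y => rfl
  have hpi : (2 * Real.pi) ≠ 0 := by positivity
  let U : Set (LeafSpace φ) := Quotient.mk (flowlineSetoid φ) '' W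
  have hU : IsOpen U := hq₂.isOpenMap W hW
  have hUW : ∀ y, (⟦y⟧ : LeafSpace φ) ∈ U ↔ y ∈ W := by
    refine fun y => ⟨?_, fun hy => ⟨y, hy, rfl⟩⟩
    rintro ⟨z, hz, hzy⟩
    obtain ⟨t, rfl⟩ := LeafSpace.mk_eq_mk.1 hzy
    exact hinv t z hz
  -- `F` and `G` read times off arbitrary representatives; `hF` and `hG` say that over `U` the choice
  -- of representative is immaterial.
  let F : OrbitSpace f → LeafSpace φ × Circle := fun a =>
    (orbitToLeaf hφ a, Circle.exp (2 * Real.pi * T a.out))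
  let G : LeafSpace φ × Circle → OrbitSpace f := fun z =>
    ⟦φ (Complex.arg z.2 / (2 * Real.pi) - T z.1.out) z.1.out⟧
  have hF : ∀ y ∈ W, F ⟦y⟧ = (⟦y⟧, Circle.exp (2 * Real.pi * T y)) := by
    intro y hy
    obtain ⟨n, hn⟩ := (OrbitSpace.mk_eq_mk hφ).1 (Quotient.out_eq (⟦y⟧ : OrbitSpace f)).symm
    refine Prod.ext rfl (Circle.exp_eq_exp.2 ⟨n, ?_⟩)
    rw [← hn, hT y hy]
    ring
  have hG : ∀ y ∈ W, ∀ θ : ℝ, G (⟦y⟧, Circle.exp θ) = ⟦φ (θ / (2 * Real.pi) - T y) y⟧ := by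
    intro y hy θ
    obtain ⟨t, ht⟩ := LeafSpace.mk_eq_mk.1 (Quotient.out_eq (⟦y⟧ : LeafSpace φ)).symm
    obtain ⟨m, hm⟩ := Circle.exp_eq_exp.1 (Circle.exp_arg (Circle.exp θ)).symm
    refine (OrbitSpace.mk_eq_mk hφ).2 ⟨m, ?_⟩
    simp only
    rw [← ht, hT y hy, ← φ.map_add, ← φ.map_add]
    congr 1
    generalize Complex.arg (Circle.exp θ : ℂ) = α at hm ⊢
    rw [hm]
    field_simp
    ring
  have hFc : ContinuousOn F (orbitToLeaf hφ ⁻¹' U) := by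
    intro a ha
    induction a using Quotient.inductionOn with | _ y =>
    have hy : y ∈ W := (hUW y).1 ha
    refine ContinuousAt.continuousWithinAt (hq₁.continuousAt_comp_iff.1 ?_)
    have hTy : ContinuousAt T y := hTc.continuousAt (hW.mem_nhds hy)
    have hc : ContinuousAt
        (fun z => ((⟦z⟧ : LeafSpace φ), Circle.exp (2 * Real.pi * T z))) y :=
      hq₂.continuous.continuousAt.prodMk
        (Circle.exp.continuous.continuousAt.comp (continuousAt_const.mul hTy))
    refine hc.congr ?_
    filter_upwards [hW.mem_nhds hy] with z hz
    exact (hF z hz).symm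
  have hGc : ContinuousOn G (U ×ˢ univ) := by
    rintro ⟨b, ζ⟩ ⟨hb, -⟩
    induction b using Quotient.inductionOn with | _ y =>
    obtain ⟨θ, rfl⟩ := Circle.exp_surjective ζ
    have hy : y ∈ W := (hUW y).1 hb
    refine ContinuousAt.continuousWithinAt
      ((hq₂.prodMap hq₃).continuousAt_comp_iff (x := (y, θ)).1 ?_)
    have hTy : ContinuousAt (fun z : Plane × ℝ => T z.1) (y, θ) :=
      ContinuousAt.comp (f := Prod.fst) (hTc.continuousAt (hW.mem_nhds hy)) continuousAt_fst
    have hc : ContinuousAt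
        (fun z : Plane × ℝ => (⟦φ (z.2 / (2 * Real.pi) - T z.1) z.1⟧ : OrbitSpace f)) (y, θ) :=
      hq₁.continuous.continuousAt.comp (φ.continuous_uncurry.continuousAt.comp
        (((continuousAt_snd.div_const _).sub hTy).prodMk continuousAt_fst))
    refine hc.congr ?_
    filter_upwards [continuousAt_fst.preimage_mem_nhds (hW.mem_nhds hy)] with z hz
    exact (hG z.1 hz z.2).symm
  have hpc : Continuous (orbitToLeaf hφ) := hq₁.continuous_comp_iff.1 hq₂.continuous
  refine ⟨{
    toFun := F
    invFun := G
    source := orbitToLeaf hφ ⁻¹' U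
    target := U ×ˢ univ
    map_source' := fun a ha => ⟨ha, mem_univ _⟩
    map_target' := ?_
    left_inv' := ?_
    right_inv' := ?_
    open_source := hU.preimage hpc
    open_target := hU.prod isOpen_univ
    continuousOn_toFun := hFc
    continuousOn_invFun := hGc
    baseSet := U
    open_baseSet := hU
    source_eq := rfl
    target_eq := rfl
    proj_toFun := fun a _ => rfl }, rfl⟩
  · rintro ⟨b, ζ⟩ ⟨hb, -⟩
    induction b using Quotient.inductionOn with | _ y =>
    obtain ⟨θ, rfl⟩ := Circle.exp_surjective ζ
    have hy : y ∈ W := (hUW y).1 hb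
    rw [hG y hy, mem_preimage, hp, hUW]
    exact hinv _ y hy
  · intro a ha
    induction a using Quotient.inductionOn with | _ y =>
    have hy : y ∈ W := (hUW y).1 ha
    rw [hF y hy, hG y hy, mul_div_cancel_left₀ _ hpi, sub_self, φ.map_zero_apply]
  · rintro ⟨b, ζ⟩ ⟨hb, -⟩
    induction b using Quotient.inductionOn with | _ y =>
    obtain ⟨θ, rfl⟩ := Circle.exp_surjective ζ
    have hy : y ∈ W := (hUW y).1 hb
    rw [hG y hy, hF _ (hinv _ y hy), hT y hy, add_sub_cancel, mul_div_cancel₀ _ hpi]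
    exact Prod.ext (LeafSpace.mk_eq_mk.2 ⟨_, rfl⟩).symm rfl

theorem mainTheorem3 (f : Plane ≃ₜ Plane) (hf : IsFreeMapping f) (φ : Flow ℝ Plane)
    (hφ : IsEmbeddedIn f φ) : IsFiberBundle Circle (orbitToLeaf hφ) := by
  intro b
  induction b using Quotient.inductionOn with | _ x =>
  obtain ⟨W, T, hW, hx, hinv, hTc, hT⟩ := φ.exists_time_coordinate
    (fun p => by rw [hφ p]; exact hf.fixedPointFree p) x
  obtain ⟨e, he⟩ := exists_trivialization_of_time_coordinate hφ hW hinv hTc hT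
  exact ⟨e, he ▸ ⟨x, hx, rfl⟩⟩
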